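/- **Morphic characterization of $K^1,K^2,K^3$.** For $\ell\in\mathbb N$, let $K^\ell$ be the two-player game on $\mathbb N^2$ (with $0\in\mathbb N$) in which the positions $(x,y)$ with $x+y\le\ell$ are terminal, and in which from any other position $(x,y)$ the player to move goes to $(x-k,y)$, $(x,y-k)$ or $(x-k,y-k)$ for some $k>0$, coordinates staying non-negative; a player who has to move from a terminal position loses. A position is a $\mathcal P$-position if none of its options is a $\mathcal P$-position. Let $(a_n,b_n)_{n\ge0}$ be the non-terminal $\mathcal P$-positions of $K^\ell$ with $a_n<b_n$, listed so that $(a_n)$ is strictly increasing, so that the set of non-terminal $\mathcal P$-positions is $\{(a_n,b_n)\mid n\ge0\}\cup\{(b_n,a_n)\mid n\ge0\}$. A word over $\{a,b\}$ with letters indexed from $\ell+1$ *codes* $(a_n,b_n)_{n\ge0}$ if, for all $n\ge0$, the index of its $(n+1)$-st letter $a$ is $a_n$ and the index of its $(n+1)$-st letter $b$ is $b_n$. Let $\mathrm{rep}_F(n)$ be the greedy (Zeckendorf) representation of $n$ as a word $d_k\cdots d_0$ over $\{0,1\}$ with $n=\sum_i d_iF_i$, where $F_0=1$, $F_1=2$,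 $F_{i+2}=F_{i+1}+F_i$, and $\mathrm{rep}_F(0)$ is the empty word. A morphism $\mu:A^*\to A^*$ is a *$\varphi$-morphism* if for every infinite fixed point $w=w_0w_1\cdots$ of $\mu$ and every $n\ge0$: $\mu(w_n)=w_{\mathrm{rep}_F(n)0}$ if $\mathrm{rep}_F(n)$ ends with $1$, and $\mu(w_n)=w_{\mathrm{rep}_F(n)0}\,w_{\mathrm{rep}_F(n)1}$ otherwise (in particular for $n=0$), where an index that is a word over $\{0,1\}$ stands for its value in the Fibonacci numeration system. Consider the following morphisms $f_\ell$ over the alphabets $\{0,\dots,4\}$, $\{0,\dots,15\}$, $\{0,\dots,21\}$ of $5$, $16$ and $22$ letters, and codings $g_\ell$ to $\{a,b\}$ (letters with two digits are in parentheses): $$\begin{aligned} f_1:\;&0\mapsto01,\ 1\mapsto2,\ 2\mapsto34,\ 3\mapsto31,\ 4\mapsto2;\\ g_1:\;&0,1,3\mapsto a,\quad 2,4\mapsto b;\\ f_2:\;&0\mapsto01,\ 1\mapsto2,\ 2\mapsto34,\ 3\mapsto56,\ 4\mapsto7,\ 5\mapsto89,\ 6\mapsto(10),\ 7\mapsto(11)(12),\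 8\mapsto(10)(13),\\ &9\mapsto(14),\ 10\mapsto(10)(13),\ 11\mapsto56,\ 12\mapsto(15),\ 13\mapsto5,\ 14\mapsto89,\ 15\mapsto(11)(12);\\ g_2:\;&0,1,2,4,6,8,9,11,12,13,14,15\mapsto a,\quad 3,5,7,10\mapsto b;\\ f_3:\;&0\mapsto01,\ 1\mapsto2,\ 2\mapsto34,\ 3\mapsto56,\ 4\mapsto7,\ 5\mapsto89,\ 6\mapsto(10),\ 7\mapsto(11)(12),\ 8\mapsto(13)(12),\\ &9\mapsto(14),\ 10\mapsto(15)(16),\ 11\mapsto(14)(17),\ 12\mapsto(18),\ 13\mapsto(14)(17),\ 14\mapsto(19)(12),\\ &15\mapsto(18)(20),\ 16\mapsto(21),\ 17\mapsto(18),\ 18\mapsto(13)(12),\ 19\mapsto(19)(12),\ 20\mapsto(14),\ 21\mapsto(15)(16);\\ g_3:\;&0,1,2,3,5,7,9,11,12,14,16,18,21\mapsto a,\quad 4,6,8,10,13,15,17,19,20\mapsto b. \end{aligned}$$ For each $\ell\in\{1,2,3\}$, $f_\ell$ is a $\varphi$-morphism, the words $f_\ell^n(0)$ converge to an infinite word $f_\ell^\omega(0)$,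 the non-terminal $\mathcal P$-positions of $K^\ell$ can be listed as $(a_n,b_n)_{n\ge0}$ as above, and they are coded by the morphic word $g_\ell(f_\ell^\omega(0))$, with letters indexed from $\ell+1$. -/

import Mathlib

namespace MorphicWythoff

/-! ### The games `K^ℓ` -/

/-- A move of the Wythoff game (a queen move towards the origin) from `p` to `q`. -/
def QueenMove (p q : ℕ × ℕ) : Prop :=
  ∃ k : ℕ, 0 < k ∧
    (p = (q.1 + k, q.2) ∨ p = (q.1, q.2 + k) ∨ p = (q.1 + k, q.2 + k))

/-- The terminal positions of `K^ℓ`. -/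
def IsTerminal (ℓ : ℕ) (p : ℕ × ℕ) : Prop := p.1 + p.2 ≤ ℓ

/-- A move of the game `K^ℓ`: Wythoff's moves, the game being over at a terminal position. -/
def Move (ℓ : ℕ) (p q : ℕ × ℕ) : Prop := ¬ IsTerminal ℓ p ∧ QueenMove p q

theorem Move.sum_lt {ℓ : ℕ} {p q : ℕ × ℕ} (h : Move ℓ p q) : q.1 + q.2 < p.1 + p.2 := by
  obtain ⟨-, k, hk, rfl | rfl | rfl⟩ := h <;> simp <;> omega

/-- The `P`-positions of `K^ℓ` under normal play (the player to move at a terminal position has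
lost): a position is a `P`-position exactly when none of its options is a `P`-position. -/
def IsPPosition (ℓ : ℕ) (p : ℕ × ℕ) : Prop :=
  ∀ q : ℕ × ℕ, Move ℓ p q → ¬ IsPPosition ℓ q
termination_by p.1 + p.2
decreasing_by exact Move.sum_lt (by assumption)

/-- `(a n, b n)`, for `n ≥ 0`, is the enumeration of the non-terminal `P`-positions of `K^ℓ`, up to
exchanging the two coordinates, with `a n < b n` and in increasing order of `a n`. -/
structure IsPEnumeration (ℓ : ℕ) (a b : ℕ → ℕ) : Prop where
  strictMono : StrictMono a
  lt : ∀ n, a n < b n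
  mem_iff : ∀ p : ℕ × ℕ, (IsPPosition ℓ p ∧ ¬ IsTerminal ℓ p) ↔
    ∃ n, p = (a n, b n) ∨ p = (b n, a n)

/-! ### Infinite words and morphisms

A morphism `A* → A*` is given by the images of the letters, `μ : A → List A`; the image of a finite
word `v` is `v.flatMap μ`. An infinite word is a map `ℕ → A`. -/

variable {A : Type*}

/-- The sequence `u` of finite words converges to the infinite word `w`, letter by letter. -/
def ConvergesTo (u : ℕ → List A) (w : ℕ → A) : Prop :=
  ∀ i : ℕ, ∃ N : ℕ, ∀ n ≥ N, (u n)[i]? = some (w i)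

/-- `w = μ^ω(c)`: the infinite word `w` is the limit of the words `μ^n(c)`. -/
def IsOmegaPower (μ : A → List A) (c : A) (w : ℕ → A) : Prop :=
  ConvergesTo (fun n => (fun v : List A => v.flatMap μ)^[n] [c]) w

/-- `w = μ(w)`: the infinite word `w` is the limit of the images `μ(w_0 ⋯ w_{n-1})`. -/
def IsFixedPoint (μ : A → List A) (w : ℕ → A) : Prop :=
  ConvergesTo (fun n => ((List.range n).map w).flatMap μ) w

/-- The greedy Fibonacci representation `rep_F(n)` ends with the digit `1`. (`Nat.zeckendorf n`
lists the indices of the Fibonacci numbers that occur in it; the least possible index is `2`.) -/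
def RepEndsWithOne (n : ℕ) : Prop := 2 ∈ Nat.zeckendorf n

/-- The value of the word `rep_F(n)0`. -/
def valAppendZero (n : ℕ) : ℕ := ((Nat.zeckendorf n).map fun i => Nat.fib (i + 1)).sum

/-- The value of the word `rep_F(n)1`. -/
def valAppendOne (n : ℕ) : ℕ := valAppendZero n + 1

/-- `μ` is a `φ`-morphism: for each of its infinite fixed points `w` and each `n`, one has
`μ(w_n) = w_{rep_F(n)0}` if `rep_F(n)` ends with `1`, and `μ(w_n) = w_{rep_F(n)0} w_{rep_F(n)1}`
otherwise (in particular for `n = 0`, whose representation is the empty word). -/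
def IsPhiMorphism (μ : A → List A) : Prop :=
  ∀ w : ℕ → A, IsFixedPoint μ w → ∀ n : ℕ,
    (RepEndsWithOne n → μ (w n) = [w (valAppendZero n)]) ∧
    (¬ RepEndsWithOne n → μ (w n) = [w (valAppendZero n), w (valAppendOne n)])

/-! ### Coding of the `P`-positions by a word over `{a, b}` -/

/-- The two letters `a` and `b`. -/
inductive AB : Type
  | a : AB
  | b : AB
  deriving DecidableEq

/-- The letter of `u` at index `i` is an occurrence of `x` preceded by exactly `n` occurrences of
`x`, the first letter of `u` having index `s`. -/
def IsOccurrence (u : ℕ → AB) (s : ℕ) (x : AB) (n i : ℕ) : Prop :=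
  ∃ k : ℕ, i = k + s ∧ u k = x ∧ Nat.count (fun j => u j = x) k = n

/-- The word `u`, with letters indexed from `s`, codes the pairs `(a n, b n)`, `n ≥ 0`: the index
of the `(n+1)`-st letter `a` is `a n` and that of the `(n+1)`-st letter `b` is `b n`. -/
def Codes (u : ℕ → AB) (s : ℕ) (a b : ℕ → ℕ) : Prop :=
  ∀ n, IsOccurrence u s AB.a n (a n) ∧ IsOccurrence u s AB.b n (b n)

/-- The non-terminal `P`-positions of `K^ℓ` are coded by the morphic word `g(f^ω(c))`, whose
letters are indexed from `ℓ + 1`. -/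
def PPositionsCodedBy (ℓ : ℕ) (f : A → List A) (c : A) (g : A → AB) : Prop :=
  ∃ (w : ℕ → A) (a b : ℕ → ℕ),
    IsOmegaPower f c w ∧ IsPEnumeration ℓ a b ∧ Codes (g ∘ w) (ℓ + 1) a b

/-! ### The explicit morphisms and codings -/

/-- The images of the letters `0, 1, …, 4`. -/
def f₁ : Fin 5 → List (Fin 5) :=
  ![[0, 1], [2], [3, 4], [3, 1], [2]]

/-- `0, 1, 3 ↦ a` and `2, 4 ↦ b`. -/
def g₁ (i : Fin 5) : AB :=
  if i ∈ ({0, 1, 3} : Finset (Fin 5)) then AB.a else AB.b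

/-- The images of the letters `0, 1, …, 15`. -/
def f₂ : Fin 16 → List (Fin 16) :=
  ![[0, 1], [2], [3, 4], [5, 6], [7], [8, 9], [10], [11, 12],
    [10, 13], [14], [10, 13], [5, 6], [15], [5], [8, 9], [11, 12]]

/-- `0, 1, 2, 4, 6, 8, 9, 11, 12, 13, 14, 15 ↦ a` and `3, 5, 7, 10 ↦ b`. -/
def g₂ (i : Fin 16) : AB :=
  if i ∈ ({0, 1, 2, 4, 6, 8, 9, 11, 12, 13, 14, 15} : Finset (Fin 16)) then AB.a else AB.b

/-- The images of the letters `0, 1, …, 21`. -/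
def f₃ : Fin 22 → List (Fin 22) :=
  ![[0, 1], [2], [3, 4], [5, 6], [7], [8, 9], [10], [11, 12],
    [13, 12], [14], [15, 16], [14, 17], [18], [14, 17], [19, 12], [18, 20],
    [21], [18], [13, 12], [19, 12], [14], [15, 16]]

/-- `0, 1, 2, 3, 5, 7, 9, 11, 12, 14, 16, 18, 21 ↦ a` and
`4, 6, 8, 10, 13, 15, 17, 19, 20 ↦ b`. -/
def g₃ (i : Fin 22) : AB :=
  if i ∈ ({0, 1, 2, 3, 5, 7, 9, 11, 12, 14, 16, 18, 21} : Finset (Fin 22)) then AB.a else AB.b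

end MorphicWythoff

namespace MorphicWythoff

/-! ### The `P`-positions of `K^ℓ` from complementary sequences -/

/-! As in Wythoff's game, two increasing sequences that partition the integers above `ℓ` and satisfy
`b n = a n + n + (ℓ + 1)` must enumerate the non-terminal `P`-positions
(`isPEnumeration_of_complementary`). A binary word codes such sequences as soon as it satisfies `u =
a^(ℓ+1) σ(u)` with `σ(a) = ba`, `σ(b) = a` (`exists_isPEnumeration_codes`).

For `u = g(w)` with `w = f^ω(c)`, this equation is made local. The image of `w n` under `f` starts
at some index `V n`, and `σ(u n)` starts at `V n + δ (w n)`, where the lag `δ` depends only on the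
letter. The equation can then be read off from the images of factors of length five. A finite set of
words containing all these factors is found by closing under `f`, so a finite computation suffices
(`IsCertificate.pPositionsCodedBy`).

The `φ`-property needs only the lengths of the images (`IsFibonacciLike`): letters with image length
2 or 1 follow the pattern of the Fibonacci word, which forces `V n` to be the value of `rep_F(n)0`.
-/

theorem QueenMove.swap {p q : ℕ × ℕ} (h : QueenMove p q) : QueenMove p.swap q.swap := by
  obtain ⟨k, hk, rfl | rfl | rfl⟩ := h
  · exact ⟨k, hk, Or.inr (Or.inl rfl)⟩
  · exact ⟨k, hk, Or.inl rfl⟩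
  · exact ⟨k, hk, Or.inr (Or.inr rfl)⟩

/-- The pairs `(a n, b n)` and their mirror images. -/
def PairSet (a b : ℕ → ℕ) (p : ℕ × ℕ) : Prop := ∃ n, p = (a n, b n) ∨ p = (b n, a n)

theorem PairSet.swap {a b : ℕ → ℕ} {p : ℕ × ℕ} (h : PairSet a b p) : PairSet a b p.swap := by
  obtain ⟨n, rfl | rfl⟩ := h
  · exact ⟨n, Or.inr rfl⟩
  · exact ⟨n, Or.inl rfl⟩

section Game

variable {ℓ : ℕ} {a b : ℕ → ℕ} (ha : StrictMono a) (hb : ∀ n, b n = a n + n + (ℓ + 1))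
  (hdisj : ∀ m n, a m ≠ b n) (hge : ∀ n, ℓ < a n) (hcov : ∀ x, ℓ < x → ∃ n, x = a n ∨ x = b n)

include ha hb hdisj hge in
-- A move preserves a coordinate or the difference of the coordinates. In a pair these all exceed
-- `ℓ`, which excludes terminal targets; distinct pairs share no coordinate and no difference.
theorem no_queenMove_of_pairSet {p q : ℕ × ℕ} (hp : PairSet a b p)
    (hq : IsTerminal ℓ q ∨ PairSet a b q) : ¬ QueenMove p q := by
  have hbm : ∀ m n, b m = b n → m = n := by
    intro m n h
    rw [hb, hb] at h
    rcases lt_trichotomy m n with hlt | heq | hlt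
    · have := ha hlt; omega
    · exact heq
    · have := ha hlt; omega
  rintro ⟨k, hk, h⟩
  obtain ⟨x, y⟩ := q
  obtain ⟨n, hp⟩ := hp
  have hn := hge n
  have hbn := hb n
  rcases hq with hq | ⟨m, hq⟩
  · simp only [IsTerminal] at hq
    rcases hp with rfl | rfl <;> simp only [Prod.mk.injEq] at h <;> omega
  · have hbm' := hb m
    have h1 := hdisj m n
    have h2 := hdisj n m
    have h3 := hbm m n
    have h4 : a m = a n → m = n := fun h => ha.injective h
    have h5 : m = n → a m = a n ∧ b m = b n := by rintro rfl; simp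
    rcases hp with rfl | rfl <;> simp only [Prod.mk.injEq] at h hq <;> omega

include ha hb hcov in
theorem exists_queenMove_of_le {x y : ℕ} (hxy : x ≤ y) (ht : ¬ IsTerminal ℓ (x, y))
    (hs : ¬ PairSet a b (x, y)) :
    ∃ q, QueenMove (x, y) q ∧ (IsTerminal ℓ q ∨ PairSet a b q) := by
  simp only [IsTerminal] at ht
  by_cases hx : x ≤ ℓ
  · exact ⟨(x, 0), ⟨y, by omega, by simp⟩, Or.inl (by simpa [IsTerminal] using hx)⟩
  by_cases hd : y - x ≤ ℓ
  · refine ⟨(0, y - x), ⟨x, by omega, ?_⟩, Or.inl (by simpa [IsTerminal] using hd)⟩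
    right; right; simp only [Prod.mk.injEq]; omega
  obtain ⟨n, rfl | rfl⟩ := hcov x (by omega)
  · rcases lt_trichotomy y (b n) with h | h | h
    · have hbn := hb n
      -- The pair of index `m` is the one on the same diagonal as `(a n, y)`.
      obtain ⟨m, hm⟩ : ∃ m, y = a n + m + (ℓ + 1) := ⟨y - a n - (ℓ + 1), by omega⟩
      have hmn := ha (show m < n by omega)
      have hbm := hb m
      refine ⟨(a m, b m), ⟨a n - a m, by omega, ?_⟩, Or.inr ⟨m, Or.inl rfl⟩⟩
      right; right; simp only [Prod.mk.injEq]; omega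
    · exact absurd ⟨n, Or.inl (by rw [h])⟩ hs
    · refine ⟨(a n, b n), ⟨y - b n, by omega, ?_⟩, Or.inr ⟨n, Or.inl rfl⟩⟩
      right; left; exact Prod.ext rfl (by simp only; omega)
  · have hbn := hb n
    refine ⟨(b n, a n), ⟨y - a n, by omega, ?_⟩, Or.inr ⟨n, Or.inr rfl⟩⟩
    right; left; exact Prod.ext rfl (by simp only; omega)

include ha hb hcov in
theorem exists_queenMove {p : ℕ × ℕ} (ht : ¬ IsTerminal ℓ p) (hs : ¬ PairSet a b p) :
    ∃ q, QueenMove p q ∧ (IsTerminal ℓ q ∨ PairSet a b q) := by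
  obtain ⟨x, y⟩ := p
  rcases le_total x y with h | h
  · exact exists_queenMove_of_le ha hb hcov h ht hs
  · obtain ⟨q, hq, hq'⟩ := exists_queenMove_of_le ha hb hcov h
      (by simpa [IsTerminal, add_comm] using ht) (fun h' => hs h'.swap)
    refine ⟨q.swap, hq.swap, hq'.imp (fun h' => ?_) PairSet.swap⟩
    simpa [IsTerminal, add_comm] using h'

include ha hb hdisj hge hcov in
theorem isPPosition_iff (p : ℕ × ℕ) : IsPPosition ℓ p ↔ IsTerminal ℓ p ∨ PairSet a b p := by
  induction hN : p.1 + p.2 using Nat.strong_induction_on generalizing p with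
  | _ N ih =>
    subst hN
    rw [IsPPosition]
    constructor
    · intro h
      by_contra hc
      rw [not_or] at hc
      obtain ⟨q, hq, hq'⟩ := exists_queenMove ha hb hcov hc.1 hc.2
      have hm : Move ℓ p q := ⟨hc.1, hq⟩
      exact h q hm ((ih _ hm.sum_lt q rfl).2 hq')
    · rintro (ht | hs) q hm hq
      · exact hm.1 ht
      · exact no_queenMove_of_pairSet ha hb hdisj hge hs ((ih _ hm.sum_lt q rfl).1 hq) hm.2

include ha hb hdisj hge hcov in
theorem isPEnumeration_of_complementary : IsPEnumeration ℓ a b where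
  strictMono := ha
  lt n := by rw [hb]; omega
  mem_iff p := by
    rw [isPPosition_iff ha hb hdisj hge hcov]
    constructor
    · rintro ⟨h | h, h'⟩
      · exact absurd h h'
      · exact h
    · intro h
      refine ⟨Or.inr h, ?_⟩
      obtain ⟨n, rfl | rfl⟩ := h <;> have := hge n <;> simp only [IsTerminal] <;> omega

end Game

/-! ### Words that are fixed by `u ↦ a^(ℓ+1) σ(u)`, where `σ(a) = ba` and `σ(b) = a` -/

section Coding

variable {u : ℕ → AB} {P : ℕ → ℕ} {s : ℕ} (h0 : P 0 = s) (hs : 0 < s) (hinit : ∀ i < s, u i = AB.a)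
  (hA : ∀ n, u n = AB.a → u (P n) = AB.b ∧ u (P n + 1) = AB.a ∧ P (n + 1) = P n + 2)
  (hB : ∀ n, u n = AB.b → u (P n) = AB.a ∧ P (n + 1) = P n + 1)

theorem AB.eq_b_iff (x : AB) : x = AB.b ↔ ¬ x = AB.a := by cases x <;> simp

include h0 hA hB in
-- `P n` is the index where `σ(u n)` starts. Each block contributes one letter, and a second one if
-- it is the image of `a`.
theorem position_eq (n : ℕ) : P n = s + n + Nat.count (fun j => u j = AB.a) n := by
  induction n with
  | zero => simp [h0]
  | succ n ih =>
    rw [Nat.count_succ]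
    by_cases h : u n = AB.a
    · rw [(hA n h).2.2, if_pos h]; omega
    · rw [(hB n ((AB.eq_b_iff _).2 h)).2, if_neg h]; omega

include h0 hinit hA hB in
theorem count_b_position (n : ℕ) :
    Nat.count (fun j => u j = AB.b) (P n) = Nat.count (fun j => u j = AB.a) n := by
  induction n with
  | zero =>
    rw [h0, Nat.count_zero, Nat.count_iff_forall_not]
    intro i hi h
    simp [hinit i hi] at h
  | succ n ih =>
    rw [Nat.count_succ]
    by_cases h : u n = AB.a
    · obtain ⟨h1, h2, h3⟩ := hA n h
      rw [h3, if_pos h, Nat.count_succ, Nat.count_succ, ih]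
      simp [h1, h2]
    · obtain ⟨h1, h2⟩ := hB n ((AB.eq_b_iff _).2 h)
      rw [h2, if_neg h, Nat.count_succ, ih]
      simp [h1]

include h0 hs hA hB in
theorem infinite_setOf_eq_a : {j | u j = AB.a}.Infinite := by
  refine Set.infinite_of_forall_exists_gt fun n => ?_
  have hP := position_eq h0 hA hB n
  by_cases h : u n = AB.a
  · exact ⟨P n + 1, (hA n h).2.1, by omega⟩
  · exact ⟨P n, (hB n ((AB.eq_b_iff _).2 h)).1, by omega⟩

include h0 hs hinit hA hB in
/-- Such a word codes the `P`-positions. -/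
theorem exists_isPEnumeration_codes {ℓ : ℕ} (hℓ : s = ℓ + 1) :
    ∃ a b : ℕ → ℕ, IsPEnumeration ℓ a b ∧ Codes u (ℓ + 1) a b := by
  have hinf := infinite_setOf_eq_a h0 hs hA hB
  set A : ℕ → ℕ := Nat.nth (fun j => u j = AB.a) with hAdef
  have huA : ∀ n, u (A n) = AB.a := fun n => Nat.nth_mem_of_infinite hinf n
  have hcA : ∀ n, Nat.count (fun j => u j = AB.a) (A n) = n := fun n =>
    Nat.count_nth_of_infinite hinf n
  have hPA : ∀ n, P (A n) = A n + n + (ℓ + 1) := fun n => by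
    rw [position_eq h0 hA hB, hcA]; omega
  have huP : ∀ n, u (P (A n)) = AB.b := fun n => (hA _ (huA n)).1
  have hcP : ∀ n, Nat.count (fun j => u j = AB.b) (P (A n)) = n := fun n => by
    rw [count_b_position h0 hinit hA hB, hcA]
  refine ⟨fun n => A n + (ℓ + 1), fun n => P (A n) + (ℓ + 1),
    isPEnumeration_of_complementary ?_ ?_ ?_ ?_ ?_, fun n => ⟨?_, ?_⟩⟩
  · exact (Nat.nth_strictMono hinf).add_const _
  · intro n
    simp only [hPA]; omega
  · intro m n h
    have h1 := huA m
    rw [Nat.add_right_cancel h, huP] at h1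
    cases h1
  · intro n
    omega
  · intro x hx
    obtain ⟨y, rfl⟩ : ∃ y, x = y + (ℓ + 1) := ⟨x - (ℓ + 1), by omega⟩
    by_cases h : u y = AB.a
    · exact ⟨Nat.count (fun j => u j = AB.a) y, Or.inl (by rw [hAdef, Nat.nth_count h])⟩
    · refine ⟨Nat.count (fun j => u j = AB.b) y, Or.inr ?_⟩
      congr 1
      -- Two occurrences of `b` preceded by equally many letters `b` coincide.
      exact Nat.count_injective (p := fun j => u j = AB.b) ((AB.eq_b_iff _).2 h) (huP _) (hcP _).symm
  · exact ⟨A n, rfl, huA n, hcA n⟩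
  · exact ⟨P (A n), rfl, huP n, hcP n⟩

end Coding

/-! ### The Fibonacci numeration system -/

theorem isChain_zeckendorf_shift {l : List ℕ} (h : (l ++ [0]).IsChain (fun a b => b + 2 ≤ a)) :
    ((l.map (· + 1)) ++ [0]).IsChain (fun a b => b + 2 ≤ a) := by
  have h' : ((l ++ [0]).map (· + 1)).IsChain (fun a b => b + 2 ≤ a) := by
    rw [List.isChain_map]
    exact h.imp fun a b hab => by omega
  rw [List.map_append] at h'
  rw [List.isChain_append] at h' ⊢
  refine ⟨h'.1, by simp, fun x hx y hy => ?_⟩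
  have := h'.2.2 x hx 1 (by simp)
  simp only [List.head?_cons, Option.mem_some_iff] at hy
  omega

theorem two_le_of_mem_zeckendorf {n i : ℕ} (hi : i ∈ Nat.zeckendorf n) : 2 ≤ i := by
  have h := Nat.isZeckendorfRep_zeckendorf n
  have : IsTrans ℕ fun a b => b + 2 ≤ a := ⟨fun a b c _ _ => by omega⟩
  rw [List.IsZeckendorfRep, List.isChain_iff_pairwise, List.pairwise_append] at h
  have := h.2.2 i hi 0 (by simp)
  omega

theorem zeckendorf_valAppendZero (n : ℕ) :
    Nat.zeckendorf (valAppendZero n) = (Nat.zeckendorf n).map (· + 1) := by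
  have h := Nat.zeckendorf_sum_fib (isChain_zeckendorf_shift (Nat.isZeckendorfRep_zeckendorf n))
  rwa [List.map_map] at h

theorem not_repEndsWithOne_valAppendZero (n : ℕ) : ¬ RepEndsWithOne (valAppendZero n) := by
  rw [RepEndsWithOne, zeckendorf_valAppendZero, List.mem_map]
  rintro ⟨i, hi, h⟩
  have := two_le_of_mem_zeckendorf hi
  omega

theorem repEndsWithOne_valAppendOne {n : ℕ} (hn : ¬ RepEndsWithOne n) :
    RepEndsWithOne (valAppendOne n) := by
  have hc := isChain_zeckendorf_shift (Nat.isZeckendorfRep_zeckendorf n)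
  have hl : List.IsZeckendorfRep ((Nat.zeckendorf n).map (· + 1) ++ [2]) := by
    rw [List.IsZeckendorfRep, List.append_assoc, List.isChain_append]
    refine ⟨(List.isChain_append.1 hc).1, by simp, fun x hx y hy => ?_⟩
    have hx' := List.mem_of_mem_getLast? hx
    rw [List.mem_map] at hx'
    obtain ⟨i, hi, rfl⟩ := hx'
    have h2 := two_le_of_mem_zeckendorf hi
    have h3 : i ≠ 2 := by rintro rfl; exact hn hi
    simp only [List.cons_append, List.head?_cons, Option.mem_some_iff] at hy
    omega
  have h := Nat.zeckendorf_sum_fib hl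
  rw [List.map_append, List.sum_append, List.map_map] at h
  have he : ((Nat.zeckendorf n).map (Nat.fib ∘ (· + 1))).sum = valAppendZero n := rfl
  rw [he] at h
  simp only [List.map_cons, List.map_nil, List.sum_cons, List.sum_nil, Nat.fib_two, add_zero] at h
  rw [RepEndsWithOne, valAppendOne, h]
  simp

theorem zeckendorf_fib_add {g r : ℕ} (hg : 2 ≤ g) (hr : r < Nat.fib (g - 1)) :
    Nat.zeckendorf (Nat.fib g + r) = g :: Nat.zeckendorf r := by
  have hpos : 0 < Nat.fib g := Nat.fib_pos.2 (by omega)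
  have hgr : Nat.greatestFib (Nat.fib g + r) = g := by
    apply le_antisymm
    · rw [← Nat.lt_succ_iff, Nat.greatestFib_lt, Nat.fib_add_one (by omega)]
      omega
    · rw [Nat.le_greatestFib]; omega
  rw [Nat.zeckendorf_of_pos (by omega), hgr, Nat.add_sub_cancel_left]

theorem valAppendZero_fib_add {g r : ℕ} (hg : 2 ≤ g) (hr : r < Nat.fib (g - 1)) :
    valAppendZero (Nat.fib g + r) = Nat.fib (g + 1) + valAppendZero r := by
  rw [valAppendZero, zeckendorf_fib_add hg hr, List.map_cons, List.sum_cons, valAppendZero]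

theorem repEndsWithOne_fib_add {g r : ℕ} (hg : 2 ≤ g) (hr : r < Nat.fib (g - 1)) :
    RepEndsWithOne (Nat.fib g + r) ↔ g = 2 ∨ RepEndsWithOne r := by
  rw [RepEndsWithOne, zeckendorf_fib_add hg hr, List.mem_cons, RepEndsWithOne, eq_comm]

@[simp] theorem valAppendZero_zero : valAppendZero 0 = 0 := by simp [valAppendZero]

theorem valAppendZero_fib {g : ℕ} (hg : 2 ≤ g) : valAppendZero (Nat.fib g) = Nat.fib (g + 1) := by
  have h := valAppendZero_fib_add (g := g) (r := 0) hg (Nat.fib_pos.2 (by omega))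
  simpa using h

theorem not_repEndsWithOne_zero : ¬ RepEndsWithOne 0 := by simp [RepEndsWithOne]

open Classical in
-- Split off the greatest Fibonacci number, `n = fib g + r`, and apply induction to `r`.
theorem valAppendZero_succ (n : ℕ) :
    valAppendZero (n + 1) = valAppendZero n + if RepEndsWithOne n then 1 else 2 := by
  induction n using Nat.strong_induction_on with
  | _ n ih =>
    rcases Nat.eq_zero_or_pos n with rfl | hn
    · have h := valAppendZero_fib (g := 2) le_rfl
      rw [Nat.fib_two] at h
      simp [h, not_repEndsWithOne_zero, show Nat.fib 3 = 2 from rfl]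
    have hle := Nat.fib_greatestFib_le n
    have hlt := Nat.lt_fib_greatestFib_add_one n
    have hg : 2 ≤ Nat.greatestFib n := by rw [Nat.le_greatestFib, Nat.fib_two]; exact hn
    generalize Nat.greatestFib n = g at hle hlt hg
    obtain ⟨r, rfl⟩ := Nat.exists_eq_add_of_le hle
    rw [Nat.fib_add_one (by omega)] at hlt
    have hr : r < Nat.fib (g - 1) := by omega
    have hpos : 0 < Nat.fib g := Nat.fib_pos.2 (by omega)
    rw [valAppendZero_fib_add hg hr, repEndsWithOne_fib_add hg hr]
    rcases hg.eq_or_lt with rfl | hg'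
    · obtain rfl : r = 0 := by simpa using hr
      have h := valAppendZero_fib (g := 3) (by norm_num)
      rw [show Nat.fib 3 = 2 from rfl, show Nat.fib (3 + 1) = 3 from rfl] at h
      simp [h, show Nat.fib 3 = 2 from rfl]
    · have ihr := ih r (by omega)
      have hR : (g = 2 ∨ RepEndsWithOne r) ↔ RepEndsWithOne r := or_iff_right (by omega)
      simp only [hR]
      rcases Nat.lt_or_ge (r + 1) (Nat.fib (g - 1)) with h | h
      · rw [add_assoc, valAppendZero_fib_add hg h, ihr, add_assoc]
      -- The carry: `n + 1` is itself the Fibonacci number `fib (g + 1)`.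
      · have hrr : r + 1 = Nat.fib (g - 1) := by omega
        rw [hrr, valAppendZero_fib (by omega), Nat.sub_add_cancel (by omega)] at ihr
        rw [add_assoc, hrr, add_assoc, ← ihr, add_comm (Nat.fib g),
          ← Nat.fib_add_one (n := g) (by omega), valAppendZero_fib (by omega),
          Nat.fib_add_one (n := g + 1) (by omega), Nat.add_sub_cancel, add_comm]

theorem exists_le_lt_succ {V : ℕ → ℕ} (h0 : V 0 = 0)
    (hV : ∀ n, V n < V (n + 1)) (m : ℕ) : ∃ n, V n ≤ m ∧ m < V (n + 1) := by
  induction m with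
  | zero => exact ⟨0, by omega, by have := hV 0; omega⟩
  | succ m ih =>
    obtain ⟨n, h1, h2⟩ := ih
    rcases Nat.lt_or_ge (m + 1) (V (n + 1)) with h | h
    · exact ⟨n, by omega, h⟩
    · exact ⟨n + 1, h, by have := hV (n + 1); omega⟩

/-! ### Fixed points of morphisms -/

section Words

variable {A : Type*}

/-- The factor of length `k` of the infinite word `w` that starts at index `s`. -/
def factor (w : ℕ → A) (s k : ℕ) : List A := (List.range k).map fun i => w (s + i)

theorem length_factor (w : ℕ → A) (s k : ℕ) : (factor w s k).length = k := by simp [factor]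

theorem factor_zero_eq (w : ℕ → A) (k : ℕ) : factor w 0 k = (List.range k).map w := by
  simp [factor]

theorem factor_add (w : ℕ → A) (s j k : ℕ) :
    factor w s (j + k) = factor w s j ++ factor w (s + j) k := by
  simp [factor, List.range_add, add_assoc]

theorem factor_succ (w : ℕ → A) (s k : ℕ) : factor w s (k + 1) = factor w s k ++ [w (s + k)] := by
  rw [factor_add]; simp [factor]

theorem factor_one (w : ℕ → A) (s : ℕ) : factor w s 1 = [w s] := by simp [factor]

theorem factor_two (w : ℕ → A) (s : ℕ) : factor w s 2 = [w s, w (s + 1)] := by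
  simp [factor_succ w s 1, factor_one]

theorem getElem?_factor {w : ℕ → A} {s k i : ℕ} (hi : i < k) :
    (factor w s k)[i]? = some (w (s + i)) := by
  simp [factor, hi]

theorem take_factor (w : ℕ → A) (s j k : ℕ) : (factor w s k).take j = factor w s (min j k) := by
  simp [factor, ← List.map_take, List.take_range]

theorem eq_factor_of_getElem? {w : ℕ → A} {l : List A} (h : ∀ i < l.length, l[i]? = some (w i)) :
    l = factor w 0 l.length := by
  apply List.ext_getElem? fun i => ?_
  rcases Nat.lt_or_ge i l.length with hi | hi
  · rw [h i hi, getElem?_factor hi, zero_add]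
  · rw [List.getElem?_eq_none hi, List.getElem?_eq_none (by rwa [length_factor])]

theorem ConvergesTo.eq_factor {v : ℕ → List A} {w : ℕ → A} (h : ConvergesTo v w)
    (hv : ∀ m n, m ≤ n → v m <+: v n) (n : ℕ) : v n = factor w 0 (v n).length := by
  refine eq_factor_of_getElem? fun i hi => ?_
  obtain ⟨N, hN⟩ := h i
  obtain ⟨t, ht⟩ := hv n (max n N) (le_max_left _ _)
  rw [← hN (max n N) (le_max_right _ _), ← ht, List.getElem?_append_left hi]

variable {f : A → List A} {c : A} {w : ℕ → A} {V : ℕ → ℕ}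

/-- The infinite word `w` is the concatenation of the words `f (w n)`, and `f (w n)` occurs in `w`
at index `V n`. -/
structure IsFixedWith (f : A → List A) (w : ℕ → A) (V : ℕ → ℕ) : Prop where
  zero : V 0 = 0
  succ : ∀ n, V (n + 1) = V n + (f (w n)).length
  image : ∀ n, f (w n) = factor w (V n) (f (w n)).length

theorem IsFixedWith.flatMap_factor (h : IsFixedWith f w V) (n k : ℕ) :
    V n + ((factor w n k).flatMap f).length = V (n + k) ∧
      (factor w n k).flatMap f = factor w (V n) ((factor w n k).flatMap f).length := by
  induction k with
  | zero => simp [factor]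
  | succ k ih =>
    rw [factor_succ, List.flatMap_append, List.length_append, ← add_assoc, ih.1, factor_add,
      ← ih.2, ih.1, ← add_assoc n, h.succ]
    simp [← h.image]

theorem exists_isFixedWith_of_flatMap
    (h : ∀ n, (factor w 0 n).flatMap f = factor w 0 ((factor w 0 n).flatMap f).length) :
    ∃ V, IsFixedWith f w V := by
  refine ⟨fun n => ((factor w 0 n).flatMap f).length, by simp [factor], fun n => ?_, fun n => ?_⟩
  · simp [factor_succ]
  · have h1 := h (n + 1)
    rw [factor_succ, List.flatMap_append, List.length_append, factor_add, ← h n, zero_add,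
      zero_add] at h1
    simpa using List.append_cancel_left h1

theorem prefix_flatMap {l l' : List A} (h : l <+: l') (f : A → List A) :
    l.flatMap f <+: l'.flatMap f := by
  obtain ⟨t, rfl⟩ := h
  exact ⟨t.flatMap f, by simp⟩

theorem factor_prefix (w : ℕ → A) (s : ℕ) {j k : ℕ} (h : j ≤ k) : factor w s j <+: factor w s k := by
  obtain ⟨i, rfl⟩ := Nat.exists_eq_add_of_le h
  exact ⟨_, (factor_add w s j i).symm⟩

theorem IsFixedPoint.exists_isFixedWith (h : IsFixedPoint f w) : ∃ V, IsFixedWith f w V := by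
  refine exists_isFixedWith_of_flatMap fun n => ?_
  have h' := ConvergesTo.eq_factor h (fun m n hmn => by
    simp only [← factor_zero_eq]
    exact prefix_flatMap (factor_prefix w 0 hmn) f) n
  simpa only [← factor_zero_eq] using h'

/-! ### Limits of the iterates of a morphism on a letter -/

section OmegaPower

variable (hc : [c] <+: f c) (hne : ∀ x, 0 < (f x).length) (hlen : 1 < (f c).length)

include hc in
theorem iterate_prefix_succ (n : ℕ) :
    (fun v : List A => v.flatMap f)^[n] [c] <+: (fun v : List A => v.flatMap f)^[n + 1] [c] := by
  induction n with
  | zero => simpa using hc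
  | succ n ih =>
    rw [Function.iterate_succ_apply', Function.iterate_succ_apply' _ (n + 1)]
    exact prefix_flatMap ih f

include hc in
theorem iterate_prefix {m n : ℕ} (h : m ≤ n) :
    (fun v : List A => v.flatMap f)^[m] [c] <+: (fun v : List A => v.flatMap f)^[n] [c] := by
  induction n, h using Nat.le_induction with
  | base => exact List.prefix_rfl
  | succ n _ ih => exact ih.trans (iterate_prefix_succ hc n)

include hne in
theorem length_le_length_flatMap (l : List A) : l.length ≤ (l.flatMap f).length := by
  induction l with
  | nil => simp
  | cons x l ih =>
    have := hne x
    simp only [List.flatMap_cons, List.length_append, List.length_cons]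
    omega

include hc hne hlen in
theorem lt_length_iterate (n : ℕ) : n < ((fun v : List A => v.flatMap f)^[n] [c]).length := by
  induction n with
  | zero => simp
  | succ n ih =>
    rw [Function.iterate_succ_apply']
    obtain ⟨t, ht⟩ := iterate_prefix (f := f) hc (Nat.zero_le n)
    rw [← ht] at ih ⊢
    have := length_le_length_flatMap hne t
    simp only [Function.iterate_zero, id_eq, List.cons_append, List.nil_append, List.flatMap_cons,
      List.length_append, List.length_cons] at ih ⊢
    omega

include hc hne hlen in
theorem exists_isOmegaPower :
    ∃ w V, IsOmegaPower f c w ∧ IsFixedWith f w V ∧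
      ∀ n, (fun v : List A => v.flatMap f)^[n] [c] =
        factor w 0 ((fun v : List A => v.flatMap f)^[n] [c]).length := by
  set v : ℕ → List A := fun n => (fun v : List A => v.flatMap f)^[n] [c] with hv
  have hvs : ∀ n, v (n + 1) = (v n).flatMap f := fun n => by
    simp only [hv]
    rw [Function.iterate_succ_apply']
  have hlt : ∀ n, n < (v n).length := lt_length_iterate hc hne hlen
  have hpre : ∀ m n, m ≤ n → v m <+: v n := fun m n h => iterate_prefix hc h
  obtain ⟨w, hw⟩ : ∃ w : ℕ → A, ∀ i, (v i)[i]? = some (w i) :=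
    ⟨fun i => (v i)[i]'(hlt i), fun i => List.getElem?_eq_getElem (hlt i)⟩
  have hconv : ConvergesTo v w := fun i => ⟨i, fun n hn => by
    obtain ⟨t, ht⟩ := hpre i n hn
    rw [← ht, List.getElem?_append_left (hlt i), hw]⟩
  have hfac := hconv.eq_factor hpre
  obtain ⟨V, hV⟩ : ∃ V, IsFixedWith f w V := by
    refine exists_isFixedWith_of_flatMap fun n => eq_factor_of_getElem? fun i hi => ?_
    -- The image of a prefix of `v n` is a prefix of `v (n + 1)`, hence of `w`.
    have h1 : factor w 0 n <+: v n := by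
      rw [hfac n]; exact factor_prefix w 0 (hlt n).le
    obtain ⟨t, ht⟩ := prefix_flatMap h1 f
    have h2 : i < (v (n + 1)).length := by
      rw [hvs, ← ht, List.length_append]; omega
    rw [← List.getElem?_append_left (l₂ := t) hi, ht, ← hvs, hfac (n + 1), getElem?_factor h2,
      zero_add]
  exact ⟨w, V, hconv, hV, hfac⟩

end OmegaPower

/-- The images of `f` have the form `x y` or `x`, with `x` a letter of the first kind and `y` a
letter of the second kind, where a letter is of the first kind if its image has length `2`, and of
the second kind if its image has length `1`. -/
def IsFibonacciLike (f : A → List A) : Prop :=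
  ∀ c, match f c with
    | [x, y] => (f x).length = 2 ∧ (f y).length = 1
    | [x] => (f x).length = 2
    | _ => False

theorem IsFibonacciLike.cases (hf : IsFibonacciLike f) (c : A) :
    (∃ x y, f c = [x, y] ∧ (f x).length = 2 ∧ (f y).length = 1) ∨
      ∃ x, f c = [x] ∧ (f x).length = 2 := by
  have h := hf c
  split at h
  · next x y hc => exact Or.inl ⟨x, y, hc, h⟩
  · next x hc => exact Or.inr ⟨x, hc, h⟩
  · exact h.elim

theorem IsFibonacciLike.length_pos (hf : IsFibonacciLike f) (c : A) : 0 < (f c).length := by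
  rcases hf.cases c with ⟨x, y, h, -⟩ | ⟨x, h, -⟩ <;> simp [h]

theorem IsFibonacciLike.length_le (hf : IsFibonacciLike f) (c : A) : (f c).length ≤ 2 := by
  rcases hf.cases c with ⟨x, y, h, -⟩ | ⟨x, h, -⟩ <;> simp [h]

/-! ### Fixed points and the Fibonacci numeration system -/

section FibonacciLike

variable (hf : IsFibonacciLike f) (h : IsFixedWith f w V)

include hf h

/-- An image of length 1 would be `w 0` itself, yet the first letter of any image is of the first
kind. -/
theorem length_image_zero : (f (w 0)).length = 2 := by
  have h0 := h.image 0
  rw [h.zero] at h0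
  rcases hf.cases (w 0) with ⟨x, y, hx, -⟩ | ⟨x, hx, hl⟩
  · simp [hx]
  · rw [hx, List.length_singleton, factor_one, List.cons.injEq] at h0
    rw [← h0.1, hl]

theorem IsFixedWith.lt_succ (n : ℕ) : V n < V (n + 1) := by
  have := hf.length_pos (w n)
  rw [h.succ]; omega

theorem IsFixedWith.lt_of_pos {n : ℕ} (hn : 0 < n) : n < V n := by
  induction n, hn using Nat.le_induction with
  | base => rw [h.succ, length_image_zero hf h]; omega
  | succ n _ ih => have := h.lt_succ hf n; omega

/-- The strict inequality `n < m` is what allows induction on the index of a letter. -/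
theorem IsFixedWith.exists_preimage {m : ℕ} (hm : 0 < m) :
    ∃ n < m, m = V n ∨ m = V n + 1 ∧ (f (w n)).length = 2 := by
  obtain ⟨n, h1, h2⟩ := exists_le_lt_succ h.zero (h.lt_succ hf) m
  have hle := hf.length_le (w n)
  rw [h.succ] at h2
  refine ⟨n, ?_, by omega⟩
  rcases Nat.eq_zero_or_pos n with rfl | hn
  · exact hm
  · have := h.lt_of_pos hf hn; omega

open Classical in
-- Both claims need a joint induction. Lengths at smaller indices give `V m`. The kind of `w m`
-- follows from its place in the image of an earlier `w n`: first letters sit at the value of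
-- `rep_F(n)0`, second letters at that of `rep_F(n)1`.
theorem length_image_eq_and_eq_valAppendZero (n : ℕ) :
    (f (w n)).length = (if RepEndsWithOne n then 1 else 2) ∧ V n = valAppendZero n := by
  induction n using Nat.strong_induction_on with
  | _ m ih =>
    have hVm : V m = valAppendZero m := by
      rcases m with _ | m
      · rw [h.zero, valAppendZero_zero]
      · rw [h.succ, valAppendZero_succ, (ih m (by omega)).1, (ih m (by omega)).2]
    refine ⟨?_, hVm⟩
    rcases Nat.eq_zero_or_pos m with rfl | hm
    · rw [length_image_zero hf h, if_neg not_repEndsWithOne_zero]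
    obtain ⟨n, hnm, h2⟩ := h.exists_preimage hf hm
    obtain ⟨ihl, ihV⟩ := ih n hnm
    have him := h.image n
    rcases hf.cases (w n) with ⟨x, y, hxy, hx, hy⟩ | ⟨x, hxy, hx⟩
    · rw [hxy, List.length_cons, List.length_singleton, factor_two, List.cons.injEq,
        List.cons.injEq] at him
      rcases h2 with rfl | ⟨rfl, -⟩
      · rw [← him.1, hx, ihV, if_neg (not_repEndsWithOne_valAppendZero n)]
      · have hR : ¬ RepEndsWithOne n := by intro hR; simp [hR, hxy] at ihl
        rw [← him.2.1, hy, ihV, if_pos]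
        exact repEndsWithOne_valAppendOne hR
    · rw [hxy, List.length_singleton, factor_one, List.cons.injEq] at him
      rcases h2 with rfl | ⟨-, h2⟩
      · rw [← him.1, hx, ihV, if_neg (not_repEndsWithOne_valAppendZero n)]
      · simp [hxy] at h2

end FibonacciLike

theorem IsFibonacciLike.isPhiMorphism (hf : IsFibonacciLike f) : IsPhiMorphism f := by
  intro w hw n
  obtain ⟨V, h⟩ := hw.exists_isFixedWith
  obtain ⟨h1, h2⟩ := length_image_eq_and_eq_valAppendZero hf h n
  have him := h.image n
  rw [h1, h2] at him
  constructor
  · intro hR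
    simpa [hR, factor_one] using him
  · intro hR
    simpa [hR, factor_two, valAppendOne] using him

end Words

/-! ### Local verification of the equation `u = a^(ℓ+1) σ(u)` -/

section Local

variable {A : Type*}

/-- The word `z`, which starts a factor `x` with `z = f(x)`, contains the image under `σ` of the
first letter of `x` at the index given by `δ`, and the next image follows at the index given
by `δ`. -/
def IsLocallyCoded (f : A → List A) (g : A → AB) (δ : A → ℕ) : List A → Prop
  | x :: y :: t =>
    let z := ((x :: y :: t).flatMap f).map g
    match g x with
    -- The last equation makes `V n + δ (w n)` advance by the length of the image under `σ`.
    | AB.a => z[δ x]? = some AB.b ∧ z[δ x + 1]? = some AB.a ∧ (f x).length + δ y = δ x + 2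
    | AB.b => z[δ x]? = some AB.a ∧ (f x).length + δ y = δ x + 1
  | _ => False

instance IsLocallyCoded.decidable [DecidableEq A] (f : A → List A) (g : A → AB) (δ : A → ℕ) :
    ∀ x, Decidable (IsLocallyCoded f g δ x)
  | [] => .isFalse id
  | [_] => .isFalse id
  | x :: y :: t => by
    unfold IsLocallyCoded
    dsimp only
    split <;> infer_instance

/-- A set `T` of words of length `5` that contains all factors of length `5` of `f^ω(c)`, and whose
elements are locally coded. -/
structure IsCertificate (ℓ : ℕ) (f : A → List A) (c : A) (g : A → AB) (δ : A → ℕ)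
    (T : List (List A)) : Prop where
  fibonacciLike : IsFibonacciLike f
  start : f c = c :: (f c).tail
  length_start : 1 < (f c).length
  delta_start : δ c = ℓ + 1
  initial : ((fun v : List A => v.flatMap f)^[4] [c]).take 5 ∈ T
  initial_eq : ∀ i < ℓ + 1, ((fun v : List A => v.flatMap f)^[4] [c])[i]?.map g = some AB.a
  length_eq : ∀ x ∈ T, x.length = 5
  image : ∀ x ∈ T, (x.flatMap f).take 5 ∈ T
  image_succ : ∀ x ∈ T, x.head?.map (fun a => (f a).length) = some 2 →
    ((x.flatMap f).drop 1).take 5 ∈ T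
  locallyCoded : ∀ x ∈ T, IsLocallyCoded f g δ x

variable {ℓ : ℕ} {f : A → List A} {c : A} {g : A → AB} {δ : A → ℕ} {T : List (List A)}

theorem drop_one_factor (w : ℕ → A) (s k : ℕ) : (factor w s k).drop 1 = factor w (s + 1) (k - 1) := by
  rcases k with _ | k
  · simp [factor]
  · rw [add_comm, factor_add, factor_one]; simp

/-- Words of `T` have length 5, so membership rules out `k < 5`. -/
theorem IsCertificate.take_factor_mem (hC : IsCertificate ℓ f c g δ T) {w : ℕ → A} {s k : ℕ}
    (h : (factor w s k).take 5 ∈ T) : factor w s 5 ∈ T := by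
  have hl := hC.length_eq _ h
  rw [take_factor, length_factor] at hl
  rwa [take_factor, hl] at h

theorem IsCertificate.factor_mem (hC : IsCertificate ℓ f c g δ T) {w : ℕ → A} {V : ℕ → ℕ}
    (h : IsFixedWith f w V) (h0 : factor w 0 5 ∈ T) (m : ℕ) : factor w m 5 ∈ T := by
  induction m using Nat.strong_induction_on with
  | _ m ih =>
    rcases Nat.eq_zero_or_pos m with rfl | hm
    · exact h0
    obtain ⟨n, hnm, h2⟩ := h.exists_preimage hC.fibonacciLike hm
    have hz := (h.flatMap_factor n 5).2
    rcases h2 with rfl | ⟨rfl, hl⟩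
    · have := hC.image _ (ih n hnm)
      rw [hz] at this
      exact hC.take_factor_mem this
    · have := hC.image_succ _ (ih n hnm) (by simp [factor, List.range_succ, hl])
      rw [hz, drop_one_factor] at this
      exact hC.take_factor_mem this

theorem apply_eq_of_getElem? {w : ℕ → A} {s k i : ℕ} {x : AB}
    (h : ((factor w s k).map g)[i]? = some x) : (g ∘ w) (s + i) = x := by
  rcases Nat.lt_or_ge i k with hi | hi
  · rw [List.getElem?_map, getElem?_factor hi] at h
    simpa using h
  · rw [List.getElem?_eq_none (by simpa [length_factor] using hi)] at h
    cases h

theorem IsCertificate.pPositionsCodedBy (hC : IsCertificate ℓ f c g δ T) :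
    PPositionsCodedBy ℓ f c g := by
  obtain ⟨w, V, hw, h, hfac⟩ := exists_isOmegaPower (f := f) (c := c)
    ⟨_, (hC.start).symm⟩ hC.fibonacciLike.length_pos hC.length_start
  have h0 : factor w 0 5 ∈ T := by
    have := hC.initial
    rw [hfac] at this
    exact hC.take_factor_mem this
  have hw0 : w 0 = c := by
    have := hfac 0
    simpa [factor_one] using this.symm
  -- No bound on `k` is needed: an index out of range would yield `none`.
  have hloc : ∀ n, ∃ k, match g (w n) with
      | AB.a => ((factor w (V n) k).map g)[δ (w n)]? = some AB.b ∧
        ((factor w (V n) k).map g)[δ (w n) + 1]? = some AB.a ∧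
        (f (w n)).length + δ (w (n + 1)) = δ (w n) + 2
      | AB.b => ((factor w (V n) k).map g)[δ (w n)]? = some AB.a ∧
        (f (w n)).length + δ (w (n + 1)) = δ (w n) + 1 := by
    intro n
    have hT := hC.locallyCoded _ (hC.factor_mem h h0 n)
    have hx : factor w n 5 = w n :: w (n + 1) :: factor w (n + 2) 3 := by
      rw [factor_add w n 2 3, factor_two]; rfl
    rw [hx, IsLocallyCoded, ← hx, (h.flatMap_factor n 5).2] at hT
    exact ⟨_, hT⟩
  have hA : ∀ n, (g ∘ w) n = AB.a → (g ∘ w) (V n + δ (w n)) = AB.b ∧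
      (g ∘ w) (V n + δ (w n) + 1) = AB.a ∧
      V (n + 1) + δ (w (n + 1)) = V n + δ (w n) + 2 := by
    intro n hn
    obtain ⟨k, hk⟩ := hloc n
    rw [show g (w n) = AB.a from hn] at hk
    refine ⟨apply_eq_of_getElem? hk.1, apply_eq_of_getElem? (i := δ (w n) + 1) hk.2.1, ?_⟩
    have := hk.2.2
    rw [h.succ]; omega
  have hB : ∀ n, (g ∘ w) n = AB.b → (g ∘ w) (V n + δ (w n)) = AB.a ∧
      V (n + 1) + δ (w (n + 1)) = V n + δ (w n) + 1 := by
    intro n hn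
    obtain ⟨k, hk⟩ := hloc n
    rw [show g (w n) = AB.b from hn] at hk
    refine ⟨apply_eq_of_getElem? hk.1, ?_⟩
    have := hk.2
    rw [h.succ]; omega
  obtain ⟨a, b, hab, hcodes⟩ := exists_isPEnumeration_codes (u := g ∘ w)
    (P := fun n => V n + δ (w n)) (s := ℓ + 1)
    (by simp [h.zero, hw0, hC.delta_start]) (Nat.succ_pos ℓ)
    (fun i hi => by
      have hi' := hC.initial_eq i hi
      rw [hfac, ← List.getElem?_map] at hi'
      simpa using apply_eq_of_getElem? hi') hA hB rfl
  exact ⟨w, a, b, hw, hab, hcodes⟩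

end Local

/-! ### The three morphisms -/

instance IsFibonacciLike.decidable {k : ℕ} (f : Fin k → List (Fin k)) :
    Decidable (IsFibonacciLike f) :=
  @Nat.decidableForallFin k _ fun c => by split <;> infer_instance

/-- The factors of length `5` of `f^k(c)` that start at one of the indices `0, …, n - 1`. -/
def fiveFactors {A : Type*} (f : A → List A) (c : A) (k n : ℕ) : List (List A) :=
  (((fun v : List A => v.flatMap f)^[k] [c]).tails.take n).map (List.take 5)

/-- The distance of `σ(u_n)` to `f₁(w_n)`, as a function of the letter `w_n`. -/
def δ₁ (i : Fin 5) : ℕ := if i = 2 then 3 else 2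

theorem isCertificate_f₁ : IsCertificate 1 f₁ 0 g₁ δ₁ (fiveFactors f₁ 0 6 9) := by
  -- The list is finite data; its closure under the two image conditions is part of what is
  -- computed.
  constructor <;> decide +kernel

/-- The distance of `σ(u_n)` to `f₂(w_n)`, as a function of the letter `w_n`. -/
def δ₂ (i : Fin 16) : ℕ := if i ∈ ({2, 3, 5, 7, 10, 14, 15} : Finset (Fin 16)) then 4 else 3

theorem isCertificate_f₂ : IsCertificate 2 f₂ 0 g₂ δ₂ (fiveFactors f₂ 0 8 42) := by
  constructor <;> decide +kernel

/-- The distance of `σ(u_n)` to `f₃(w_n)`, as a function of the letter `w_n`. -/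
def δ₃ (i : Fin 22) : ℕ := if i ∈ ({0, 1, 9, 11, 12, 16} : Finset (Fin 22)) then 4 else 5

theorem isCertificate_f₃ : IsCertificate 3 f₃ 0 g₃ δ₃ (fiveFactors f₃ 0 9 55) := by
  constructor <;> decide +kernel

end MorphicWythoff

theorem mainTheorem12 :
    (MorphicWythoff.IsPhiMorphism MorphicWythoff.f₁ ∧
      MorphicWythoff.PPositionsCodedBy 1 MorphicWythoff.f₁ 0 MorphicWythoff.g₁) ∧
    (MorphicWythoff.IsPhiMorphism MorphicWythoff.f₂ ∧
      MorphicWythoff.PPositionsCodedBy 2 MorphicWythoff.f₂ 0 MorphicWythoff.g₂) ∧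
    (MorphicWythoff.IsPhiMorphism MorphicWythoff.f₃ ∧
      MorphicWythoff.PPositionsCodedBy 3 MorphicWythoff.f₃ 0 MorphicWythoff.g₃) :=
  ⟨⟨MorphicWythoff.isCertificate_f₁.fibonacciLike.isPhiMorphism,
      MorphicWythoff.isCertificate_f₁.pPositionsCodedBy⟩,
    ⟨MorphicWythoff.isCertificate_f₂.fibonacciLike.isPhiMorphism,
      MorphicWythoff.isCertificate_f₂.pPositionsCodedBy⟩,
    ⟨MorphicWythoff.isCertificate_f₃.fibonacciLike.isPhiMorphism,
      MorphicWythoff.isCertificate_f₃.pPositionsCodedBy⟩⟩
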